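/- Let $\mathbb A$ be a relational structure with finite universe $A$, let $\theta \ge 2$ be an integer, and suppose that $\mathbb A$ contains every singleton unary relation $\{a\}$, $a \in A$, and that all relations of $\mathbb A$ have arity at most $\theta$. Let $\mathbf A = \mathrm{Pol}\,\mathbb A$ be the algebra with universe $A$ whose basic operations are all the polymorphisms of $\mathbb A$ (the finitary operations on $A$, of positive arity, that preserve every relation of $\mathbb A$). Let $B$ be a Jónsson absorbing subuniverse of $\mathbf A$; that is, $B$ is a subset of $A$ closed under all operations of $\mathbf A$, and there are an integer $n \ge 0$ and ternary terms $d_0, d_1, \dots, d_n$ of $\mathbf A$ such that \[ \begin{aligned} & d_i(B,A,B) \subseteq B && \text{for all } i \le n,\\ & d_i(x,y,y) = d_{i+1}(x,x,y) && \text{for all } i < n \text{ and } x,y \in A,\\ & d_0(x,y,z) = x \ \text{ and } \ d_n(x,y,z) = z && \text{for all } x,y,z \in A. \end{aligned} \] Then $B$ absorbs $\mathbf A$ via a term of arity at most \[ \kappa = \tfrac12 (2\theta-2)^{3^{|A|}} + 1 , \] that is, there are an integer $m$ with $1 \le m \le \kappa$ and an $m$-ary term $t$ of $\mathbf A$ that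 is idempotent, $t(a,a,\dots,a) = a$ for all $a \in A$, and satisfies $t(B,\dots,B,A,B,\dots,B) \subseteq B$ for each of the $m$ possible positions of $A$. -/

import Mathlib

namespace Absorption

universe u v w

/-- An `n`-ary operation `f` on `A` is a polymorphism of the `L`-structure `A` if it preserves
every relation of the structure: whenever all `n` rows of a matrix `M` lie in a `k`-ary relation `R`,
the tuple obtained by applying `f` to the `k` columns of `M` lies in `R`. -/
def IsPolymorphism (L : FirstOrder.Language.{u, v}) {A : Type w} [L.Structure A] {n : ℕ}
    (f : (Fin n → A) → A) : Prop :=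
  ∀ ⦃k : ℕ⦄ (R : L.Relations k) (M : Fin n → Fin k → A),
    (∀ i, FirstOrder.Language.Structure.RelMap R (M i)) →
      FirstOrder.Language.Structure.RelMap R (fun j => f (fun i => M i j))

/-- The signature of the polymorphism algebra of the `L`-structure `A`: one function symbol for each
polymorphism of positive arity, and no relation symbols. -/
def Pol (L : FirstOrder.Language.{u, v}) (A : Type w) [L.Structure A] : FirstOrder.Language.{w, 0} where
  Functions n := {f : (Fin n → A) → A // 0 < n ∧ IsPolymorphism L f}
  Relations _ := Empty

/-- The polymorphism algebra itself: each symbol is interpreted by the polymorphism it names. -/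
instance polAlgebra (L : FirstOrder.Language.{u, v}) (A : Type w) [L.Structure A] : (Pol L A).Structure A where
  funMap f x := f.1 x
  RelMap r _ := Empty.elim r

section Algebra

variable {F : FirstOrder.Language.{u, v}} {A : Type w} [F.Structure A]

/-- The `n`-ary term `t` (of positive arity) of the algebra `A` is idempotent and satisfies
`t(B, …, B, A, B, …, B) ⊆ B` for every position of `A`. -/
def IsAbsorptionTerm (B : F.Substructure A) {n : ℕ} (t : F.Term (Fin n)) : Prop :=
  0 < n ∧
  (∀ a : A, t.realize (fun _ => a) = a) ∧
  ∀ (i : Fin n) (x : Fin n → A), (∀ j, j ≠ i → x j ∈ B) → t.realize x ∈ B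

/-- The ternary terms `d 0, …, d n` of the algebra `A` form a (directed) Jónsson absorption chain
for the subuniverse `B`. -/
def IsJonssonAbsorptionChain (B : F.Substructure A) (n : ℕ) (d : ℕ → F.Term (Fin 3)) : Prop :=
  (∀ i ≤ n, ∀ b ∈ B, ∀ a : A, ∀ c ∈ B, (d i).realize ![b, a, c] ∈ B) ∧
  (∀ i < n, ∀ x y : A, (d i).realize ![x, y, y] = (d (i + 1)).realize ![x, x, y]) ∧
  (∀ x y z : A, (d 0).realize ![x, y, z] = x) ∧
  (∀ x y z : A, (d n).realize ![x, y, z] = z)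

/-- The subuniverse `B` of the algebra `A` is Jónsson absorbing. -/
def IsJonssonAbsorbing (B : F.Substructure A) : Prop :=
  ∃ (n : ℕ) (d : ℕ → F.Term (Fin 3)), IsJonssonAbsorptionChain B n d

/-- The subuniverse `B` absorbs the algebra `A` via an `n`-ary term. -/
def AbsorbsViaArity (B : F.Substructure A) (n : ℕ) : Prop :=
  ∃ t : F.Term (Fin n), IsAbsorptionTerm B t

end Algebra

end Absorption

/-! Put m = θ^(3^|A|-1) + 1. The desired term solves a constraint problem: the variables are the
m-tuples over A, a solution is an m-ary polymorphism, and each tuple with at most one entry outside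
B must be sent into B. Since the relations have arity at most θ, the set R of polymorphisms is
determined by its restrictions to θ variables. Label each restricted tuple by its exceptional
position; the i-th projection then meets every demand whose label is not i.

Two facts give a solution. By `ArcConsistent.exists_assignment`, arc consistency suffices: a minimal
arc consistent family has no proper absorbing subsets (`ArcConsistent.exists_smaller`), and then the
loop lemma `IsJonssonChain.exists_loop` imposes the edges one by one. Arc consistency itself is
available once all tree instances are satisfiable.

By `Tree.leafCount_le_of_critical`, an unsatisfiable tree with fewest constrained leaves has at most
θ^(3^|A|-1) of them. Going down the tree, every place at which all children lose leaves carries a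
disjoint pair (values offered from below, values accepted from above). On one branch these pairs are
distinct by `IsJonssonChain.separation`, and only 3^|A| disjoint pairs exist. But so small a tree
misses one of the m labels and is satisfied by a projection.

Both facts rest on `IsJonssonChain.connect`: if S absorbs T, the Jónsson chain turns a T-walk
between looped vertices into an S-walk. -/

namespace JonssonAbsorption

/-! ### Walks in a binary relation and idempotent powers. -/

section Iter

variable {X : Type*}

/-- The `n`-fold composition of a binary relation with itself. -/
def relIter (S : X → X → Prop) : ℕ → X → X → Prop
  | 0 => fun a b => a = b
  | n + 1 => fun a b => ∃ c, relIter S n a c ∧ S c b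

theorem relIter_add {S : X → X → Prop} {m n : ℕ} {a b : X} :
    relIter S (m + n) a b ↔ ∃ c, relIter S m a c ∧ relIter S n c b := by
  induction n generalizing b with
  | zero => simp [relIter]
  | succ n ih =>
    rw [← add_assoc]
    simp only [relIter, ih]
    constructor
    · rintro ⟨c, ⟨e, h1, h2⟩, h3⟩
      exact ⟨e, h1, c, h2, h3⟩
    · rintro ⟨e, h1, c, h2, h3⟩
      exact ⟨c, ⟨e, h1, h2⟩, h3⟩

theorem relIter_trans {S : X → X → Prop} {m n : ℕ} {a b c : X}
    (h : relIter S m a b) (h' : relIter S n b c) : relIter S (m + n) a c :=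
  relIter_add.2 ⟨b, h, h'⟩

theorem relIter_one {S : X → X → Prop} {a b : X} : relIter S 1 a b ↔ S a b := by
  simp [relIter]

theorem relIter_mono {S T : X → X → Prop} (h : ∀ a b, S a b → T a b) {n : ℕ} {a b : X}
    (hab : relIter S n a b) : relIter T n a b := by
  induction n generalizing b with
  | zero => exact hab
  | succ n ih =>
    obtain ⟨c, h1, h2⟩ := hab
    exact ⟨c, ih h1, h _ _ h2⟩

theorem reflTransGen_of_relIter {S : X → X → Prop} {n : ℕ} {a b : X}
    (h : relIter S n a b) : Relation.ReflTransGen S a b := by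
  induction n generalizing b with
  | zero => exact h ▸ Relation.ReflTransGen.refl
  | succ n ih =>
    obtain ⟨c, h1, h2⟩ := h
    exact (ih h1).tail h2

theorem exists_relIter_of_reflTransGen {S : X → X → Prop} {a b : X}
    (h : Relation.ReflTransGen S a b) : ∃ n, relIter S n a b := by
  induction h with
  | refl => exact ⟨0, rfl⟩
  | tail _ h2 ih =>
    obtain ⟨n, hn⟩ := ih
    exact ⟨n + 1, _, hn, h2⟩

/-- Walks in a relation that is reflexive at their end may be prolonged. -/
theorem relIter_pad {T : X → X → Prop} {m n : ℕ} {a b : X} (hb : T b b) (h : relIter T m a b)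
    (hmn : m ≤ n) : relIter T n a b := by
  induction hmn with
  | refl => exact h
  | step _ ih => exact ⟨b, ih, hb⟩

/-- Some power of a relation on a finite set is idempotent. -/
theorem exists_relIter_idem [Finite X] (S : X → X → Prop) :
    ∃ N, 0 < N ∧ relIter S (N + N) = relIter S N := by
  obtain ⟨i, j, hij, h⟩ := Finite.exists_ne_map_eq_of_infinite (relIter S)
  wlog hlt : i < j generalizing i j
  · exact this j i hij.symm h.symm (by omega)
  obtain ⟨m, rfl⟩ : ∃ m, j = i + m := ⟨j - i, by omega⟩
  have hm : 0 < m := by omega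
  have shift : ∀ k, relIter S (i + k + m) = relIter S (i + k) := by
    intro k
    ext a b
    rw [show i + k + m = i + m + k by omega, relIter_add, relIter_add, h]
  have shift' : ∀ l k, relIter S (i + k + m * l) = relIter S (i + k) := by
    intro l
    induction l with
    | zero => simp
    | succ l ih =>
      intro k
      rw [show i + k + m * (l + 1) = i + (k + m * l) + m by ring, shift, ← add_assoc, ih]
  -- A multiple of the period `m` that is at least the preperiod `i`.
  refine ⟨m * (i + 1), by positivity, ?_⟩
  have hle : i ≤ m * (i + 1) := by nlinarith
  obtain ⟨k, hk⟩ := Nat.exists_eq_add_of_le hle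
  calc relIter S (m * (i + 1) + m * (i + 1)) = relIter S (i + k + m * (i + 1)) := by rw [← hk]
    _ = relIter S (i + k) := shift' _ _
    _ = _ := by rw [← hk]

theorem relIter_idem_mul {S : X → X → Prop} {N : ℕ} (h : relIter S (N + N) = relIter S N) :
    ∀ k, 0 < k → relIter S (k * N) = relIter S N := by
  intro k hk
  induction k, hk using Nat.le_induction with
  | base => simp
  | succ k _ ih =>
    rw [← h]
    ext a b
    rw [Nat.succ_mul, relIter_add, relIter_add, ih]

theorem relIter_idem_trans {S : X → X → Prop} {N : ℕ} (h : relIter S (N + N) = relIter S N)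
    {a b c : X} (hab : relIter S N a b) (hbc : relIter S N b c) : relIter S N a c := by
  rw [← h]; exact relIter_trans hab hbc

/-- In a set whose elements all have `Q`-successors in it, for a transitive `Q` on a finite type, each
element has a successor with a loop. -/
theorem exists_loop_succ [Finite X] {Q : X → X → Prop} (htr : ∀ a b c, Q a b → Q b c → Q a c)
    {C : Set X} (hC : ∀ a ∈ C, ∃ b ∈ C, Q a b) {c : X} (hc : c ∈ C) : ∃ x ∈ C, Q c x ∧ Q x x := by
  choose! s hsC hs using hC
  have hmem : ∀ n, s^[n] c ∈ C := by
    intro n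
    induction n with
    | zero => exact hc
    | succ n ih => rw [Function.iterate_succ_apply']; exact hsC _ ih
  have hlt : ∀ i k, Q (s^[i] c) (s^[i + 1 + k] c) := by
    intro i k
    induction k with
    | zero => simpa only [add_zero, Function.iterate_succ_apply'] using hs _ (hmem i)
    | succ k ih =>
      refine htr _ _ _ ih ?_
      rw [show i + 1 + (k + 1) = (i + 1 + k) + 1 by ring, Function.iterate_succ_apply' _ (i + 1 + k)]
      exact hs _ (hmem _)
  obtain ⟨i, j, hij, h⟩ := Finite.exists_ne_map_eq_of_infinite (fun n => s^[n + 1] c)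
  wlog hl : i < j generalizing i j
  · exact this j i hij.symm h.symm (by omega)
  obtain ⟨k, rfl⟩ : ∃ k, j = i + 1 + k := ⟨j - (i + 1), by omega⟩
  refine ⟨s^[i + 1] c, hmem _, ?_, ?_⟩
  · simpa [add_comm] using hlt 0 i
  · have h2 := hlt (i + 1) k
    have h3 : s^[i + 1] c = s^[i + 1 + k + 1] c := h
    rwa [show i + 1 + 1 + k = i + 1 + k + 1 by ring, ← h3] at h2

theorem relIter_stay_succ {S : X → X → Prop} {C : Set X} (hC : ∀ a ∈ C, ∃ b ∈ C, S a b) (n : ℕ) :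
    ∀ a ∈ C, ∃ b ∈ C, relIter S n a b := by
  induction n with
  | zero => exact fun a ha => ⟨a, ha, rfl⟩
  | succ n ih =>
    intro a ha
    obtain ⟨b, hb, hab⟩ := ih a ha
    obtain ⟨c, hc, hbc⟩ := hC b hb
    exact ⟨c, hc, b, hab, hbc⟩

theorem relIter_stay_pred {S : X → X → Prop} {C : Set X} (hC : ∀ a ∈ C, ∃ b ∈ C, S b a) (n : ℕ) :
    ∀ a ∈ C, ∃ b ∈ C, relIter S n b a := by
  induction n with
  | zero => exact fun a ha => ⟨a, ha, rfl⟩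
  | succ n ih =>
    intro a ha
    obtain ⟨b, hb, hab⟩ := hC a ha
    obtain ⟨c, hc, hbc⟩ := ih b hb
    exact ⟨c, hc, b, hbc, hab⟩

/-- An element of a set with `S`-predecessors in the set is reached from a looped element. -/
theorem exists_loop_relIter_pred [Finite X] {S : X → X → Prop} {N : ℕ}
    (hN : relIter S (N + N) = relIter S N) {C : Set X} (hC : ∀ a ∈ C, ∃ b ∈ C, S b a) {c : X}
    (hc : c ∈ C) : ∃ x ∈ C, relIter S N x c ∧ relIter S N x x :=
  exists_loop_succ (Q := fun a b => relIter S N b a)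
    (fun _ _ _ h h' => relIter_idem_trans hN h' h) (relIter_stay_pred hC N) hc

theorem exists_loop_relIter_succ [Finite X] {S : X → X → Prop} {N : ℕ}
    (hN : relIter S (N + N) = relIter S N) {C : Set X} (hC : ∀ a ∈ C, ∃ b ∈ C, S a b) {c : X}
    (hc : c ∈ C) : ∃ x ∈ C, relIter S N c x ∧ relIter S N x x :=
  exists_loop_succ (Q := relIter S N)
    (fun _ _ _ h h' => relIter_idem_trans hN h h') (relIter_stay_succ hC N) hc

end Iter

/-! ### Jónsson chains acting on walks; the loop lemma. -/

/-- Ternary operations `d 0, …, d n` linked as in the definition of Jónsson absorption. -/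
structure IsJonssonChain {X : Type*} (n : ℕ) (d : ℕ → X → X → X → X) : Prop where
  first : ∀ x y z, d 0 x y z = x
  last : ∀ x y z, d n x y z = z
  link : ∀ i < n, ∀ x y, d i x y y = d (i + 1) x x y

/-- `S` absorbs `T` by means of `d`: `d i (S, T, S) ⊆ S` for all `i ≤ n`. -/
def RelAbsorbs {X : Type*} (n : ℕ) (d : ℕ → X → X → X → X) (S T : X → X → Prop) : Prop :=
  ∀ i ≤ n, ∀ a a' b b' c c', S a a' → T b b' → S c c' → S (d i a b c) (d i a' b' c')

section Chain

variable {X : Type*} {n : ℕ} {d : ℕ → X → X → X → X}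

theorem IsJonssonChain.idem (hd : IsJonssonChain n d) (x : X) : ∀ i ≤ n, d i x x x = x := by
  intro i
  induction i with
  | zero => exact fun _ => hd.first _ _ _
  | succ i ih => exact fun hi => (hd.link i hi x x).symm.trans (ih (by omega))

theorem RelAbsorbs.relIter {S T : X → X → Prop} (h : RelAbsorbs n d S T) (m : ℕ) :
    RelAbsorbs n d (relIter S m) (relIter T m) := by
  induction m with
  | zero =>
    rintro i - a _ b _ c _ rfl rfl rfl
    rfl
  | succ m ih =>
    rintro i hi a a' b b' c c' ⟨x, h1, h2⟩ ⟨y, h3, h4⟩ ⟨z, h5, h6⟩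
    exact ⟨_, ih i hi _ _ _ _ _ _ h1 h3 h5, h i hi _ _ _ _ _ _ h2 h4 h6⟩

theorem RelAbsorbs.comp {S T S' T' : X → X → Prop} (h : RelAbsorbs n d S T)
    (h' : RelAbsorbs n d S' T') :
    RelAbsorbs n d (Relation.Comp S S') (Relation.Comp T T') := by
  rintro i hi a a' b b' c c' ⟨x, h1, h2⟩ ⟨y, h3, h4⟩ ⟨z, h5, h6⟩
  exact ⟨_, h i hi _ _ _ _ _ _ h1 h3 h5, h' i hi _ _ _ _ _ _ h2 h4 h6⟩

/-- Two looped vertices joined by a `T`-walk are joined by an `S`-walk, if `S` absorbs `T`. -/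
theorem IsJonssonChain.connect (hd : IsJonssonChain n d) {S T : X → X → Prop}
    (hST : RelAbsorbs n d S T) {N : ℕ} (hN : relIter S (N + N) = relIter S N) {x y : X}
    (hx : relIter S N x x) (hy : relIter S N y y) {k : ℕ} (hk : 0 < k)
    (hxy : relIter T (k * N) x y) : relIter S N x y := by
  -- The outer arguments stay on their `S`-loops while the middle one travels along the `T`-walk
  -- from `x` to `y`.
  have step : ∀ i ≤ n, relIter S N (d i x x y) (d i x y y) := by
    intro i hi
    rw [← relIter_idem_mul hN k hk] at hx hy ⊢
    exact hST.relIter _ i hi _ _ _ _ _ _ hx hxy hy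
  have key : ∀ i ≤ n, relIter S N x (d i x x y) := by
    intro i
    induction i with
    | zero => intro _; rw [hd.first]; exact hx
    | succ i ih =>
      intro hi
      rw [← hd.link i hi]
      exact relIter_idem_trans hN (ih (by omega)) (step i (by omega))
  have := key n le_rfl
  rwa [hd.last] at this

/-- The connectivity argument behind the bound on the number of leaves of a critical tree. -/
theorem IsJonssonChain.separation [Finite X] (hd : IsJonssonChain n d) {S T : X → X → Prop}
    (hST : RelAbsorbs n d S T) (hle : ∀ a b, S a b → T a b) {C E : Set X}
    (hCpred : ∀ a ∈ C, ∃ b ∈ C, S b a) (hCS : ∀ a ∈ C, ∀ b, S a b → b ∈ C)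
    (hEsucc : ∀ a ∈ E, ∃ b ∈ E, S a b) {c e : X} (hc : c ∈ C) (he : e ∈ E) (hce : T c e) :
    ∃ a, a ∈ C ∧ a ∈ E := by
  obtain ⟨N, hN0, hN⟩ := exists_relIter_idem S
  obtain ⟨x, hxC, hxc, hxx⟩ := exists_loop_relIter_pred hN hCpred hc
  -- The single edge from `c` to `e` is padded by `N - 1` steps inside `E`, so that the walk from
  -- `x` to `y` has length `3 * N`, a multiple of `N`.
  obtain ⟨e', he', hee'⟩ := relIter_stay_succ hEsucc (N - 1) e he
  obtain ⟨y, hyE, hey, hyy⟩ := exists_loop_relIter_succ hN hEsucc he'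
  have hxy : relIter T (3 * N) x y := by
    have h1 := relIter_trans (relIter_trans (relIter_mono hle hxc) (relIter_one.2 hce))
      (relIter_trans (relIter_mono hle hee') (relIter_mono hle hey))
    rwa [show N + 1 + (N - 1 + N) = 3 * N by omega] at h1
  have h := hd.connect hST hN hxx hyy (by norm_num) hxy
  have stay : ∀ m b, relIter S m x b → b ∈ C := by
    intro m
    induction m with
    | zero => rintro b rfl; exact hxC
    | succ m ih => rintro b ⟨c, h1, h2⟩; exact hCS c (ih c h1) b h2
  exact ⟨y, stay _ _ h, hyE⟩

/-- If `S` is subdirect on `P` and its `T`-connectivity is witnessed by a symmetric relation `Q`, then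
`Q`-connected elements of `P` are `S`-connected. -/
theorem IsJonssonChain.reflTransGen_of_symmetric [Finite X] (hd : IsJonssonChain n d)
    {S T Q : X → X → Prop} (hST : RelAbsorbs n d S T) {P : Set X}
    (hsucc : ∀ a ∈ P, ∃ b ∈ P, S a b) (hpred : ∀ a ∈ P, ∃ b ∈ P, S b a)
    (hSQ : ∀ a b, S a b → a ∈ P → Relation.ReflTransGen Q a b) (hQ : ∀ a b, Q a b → Q b a)
    (hQT : ∀ a b, Q a b → T a b) (hT : ∀ a ∈ P, T a a)
    (hSP : ∀ a b, S a b → a ∈ P → b ∈ P) {a b : X} (ha : a ∈ P)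
    (hb : b ∈ P) (hab : Relation.ReflTransGen Q a b) : Relation.ReflTransGen S a b := by
  obtain ⟨N, hN0, hN⟩ := exists_relIter_idem S
  obtain ⟨x, hxP, hax, hxx⟩ := exists_loop_relIter_succ hN hsucc ha
  obtain ⟨y, hyP, hyb, hyy⟩ := exists_loop_relIter_pred hN hpred hb
  have iterQ : ∀ m a b, a ∈ P → relIter S m a b → b ∈ P ∧ Relation.ReflTransGen Q a b := by
    intro m
    induction m with
    | zero => rintro a b ha rfl; exact ⟨ha, .refl⟩
    | succ m ih =>
      rintro a b ha ⟨c, h1, h2⟩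
      obtain ⟨hc, hac⟩ := ih a c ha h1
      exact ⟨hSP _ _ h2 hc, hac.trans (hSQ _ _ h2 hc)⟩
  have : Std.Symm Q := ⟨fun a b => hQ a b⟩
  have hsymm : ∀ a b, Relation.ReflTransGen Q a b → Relation.ReflTransGen Q b a :=
    fun a b => Relation.ReflTransGen.stdSymm.symm a b
  -- Symmetry of `Q` allows the walks from `a` to `x` and from `y` to `b` to be traversed backwards.
  have hxy : Relation.ReflTransGen Q x y :=
    ((hsymm _ _ (iterQ _ _ _ ha hax).2).trans hab).trans (hsymm _ _ (iterQ _ _ _ hyP hyb).2)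
  obtain ⟨m, hm⟩ := exists_relIter_of_reflTransGen hxy
  have hT' : relIter T ((m + 1) * N) x y :=
    relIter_pad (hT y hyP) (relIter_mono hQT hm) (by nlinarith)
  have h := hd.connect hST hN hxx hyy (Nat.succ_pos m) hT'
  exact (reflTransGen_of_relIter hax).trans
    ((reflTransGen_of_relIter h).trans (reflTransGen_of_relIter hyb))

/-- The loop lemma for Jónsson absorption: a relation that contains closed walks and absorbs a
reflexive relation has a loop. -/
theorem IsJonssonChain.exists_loop [Finite X] (hd : IsJonssonChain n d) {S T : X → X → Prop}
    (hST : RelAbsorbs n d S T) (hle : ∀ a b, S a b → T a b) {P : Set X} (hT : ∀ a ∈ P, T a a)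
    (hP : ∀ i ≤ n, ∀ a ∈ P, ∀ b ∈ P, ∀ c ∈ P, d i a b c ∈ P)
    {C : Set X} (hCP : C ⊆ P) (hCne : C.Nonempty) (hC : ∀ a ∈ C, ∃ b ∈ C, S b a) :
    ∃ a, S a a := by
  induction hcard : P.ncard using Nat.strong_induction_on generalizing P C with
  | _ r ih =>
  subst hcard
  set S' : X → X → Prop := fun a b => S a b ∧ a ∈ P ∧ b ∈ P with hS'
  set T' : X → X → Prop := fun a b => T a b ∧ a ∈ P ∧ b ∈ P with hT'
  have hle' : ∀ a b, S' a b → T' a b := fun a b h => ⟨hle _ _ h.1, h.2⟩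
  have hST' : RelAbsorbs n d S' T' := fun i hi a a' b b' c c' h1 h2 h3 =>
    ⟨hST i hi _ _ _ _ _ _ h1.1 h2.1 h3.1, hP i hi _ h1.2.1 _ h2.2.1 _ h3.2.1,
      hP i hi _ h1.2.2 _ h2.2.2 _ h3.2.2⟩
  have hC' : ∀ a ∈ C, ∃ b ∈ C, S' b a := fun a ha => by
    obtain ⟨b, hb, h⟩ := hC a ha
    exact ⟨b, hb, h, hCP hb, hCP ha⟩
  obtain ⟨N, hN0, hN⟩ := exists_relIter_idem S'
  obtain ⟨c0, hc0⟩ := hCne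
  obtain ⟨u, huC, -, huu⟩ := exists_loop_relIter_pred hN hC' hc0
  have huP : u ∈ P := hCP huC
  have ball_sub : ∀ K, {b | relIter S' K u b} ⊆ P := by
    rintro (_ | K) b hb
    · exact (show u = b from hb) ▸ huP
    · obtain ⟨c, -, h⟩ := hb
      exact h.2.2
  -- Balls around `u` are closed because `d i u u u = u`.
  have ball_closed : ∀ K, ∀ i ≤ n, ∀ a ∈ {b | relIter S' K u b}, ∀ b ∈ {b | relIter S' K u b},
      ∀ c ∈ {b | relIter S' K u b}, d i a b c ∈ {b | relIter S' K u b} := by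
    intro K i hi a ha b hb c hc
    have := hST'.relIter K i hi _ _ _ _ _ _ ha (relIter_mono hle' hb) hc
    rwa [hd.idem u i hi] at this
  -- If the ball fills `P`, the last radius before filling gives a proper ball in which every
  -- element has a predecessor. Otherwise the ball is itself proper, and it contains the strong
  -- component of `u`, where predecessors exist.
  by_cases hX : {b | relIter S' N u b} = P
  · classical
    have hex : ∃ K, {b | relIter S' K u b} = P := ⟨N, hX⟩
    have hmin := fun m => Nat.find_min hex (m := m)
    have hsp := Nat.find_spec hex
    generalize Nat.find hex = K at hmin hsp
    rcases K with _ | K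
    · obtain ⟨v, hv, hvu⟩ := hC u huC
      have : u = v := by
        have h := hCP hv
        rw [← hsp] at h
        exact h
      exact ⟨u, by rwa [← this] at hvu⟩
    · have hlt : {b | relIter S' K u b} ⊂ P :=
        (ball_sub K).ssubset_of_ne (hmin K (Nat.lt_succ_self K))
      refine ih _ (Set.ncard_lt_ncard hlt) (P := {b | relIter S' K u b})
        (fun a ha => hT a (ball_sub K ha)) (ball_closed K) subset_rfl ?_ ?_ rfl
      · rw [← hsp] at huP
        obtain ⟨c, hc, -⟩ := huP
        exact ⟨c, hc⟩
      · intro b hb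
        have hb' := ball_sub K hb
        rw [← hsp] at hb'
        obtain ⟨c, hc, hcb⟩ := hb'
        exact ⟨c, hc, hcb.1⟩
  · have hlt := (ball_sub N).ssubset_of_ne hX
    refine ih _ (Set.ncard_lt_ncard hlt) (P := {b | relIter S' N u b})
      (fun a ha => hT a (ball_sub N ha)) (ball_closed N)
      (C := {w | ∃ i j, relIter S' (i + 1) u w ∧ relIter S' j w u}) ?_ ?_ ?_ rfl
    · rintro w ⟨i, j, hi, hj⟩
      have hwP : w ∈ P := ball_sub (i + 1) hi
      have hww : relIter S' N w w := by
        have hcyc : relIter S' (j + (i + 1)) w w := relIter_trans hj hi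
        have hall : ∀ k, relIter S' (k * (j + (i + 1))) w w := by
          intro k
          induction k with
          | zero => simp [relIter]
          | succ k ih' => rw [Nat.succ_mul]; exact relIter_trans ih' hcyc
        have := hall N
        rwa [mul_comm, relIter_idem_mul hN _ (by omega)] at this
      exact hd.connect hST' hN huu hww (Nat.succ_pos i)
        (relIter_pad ⟨hT w hwP, hwP, hwP⟩ (relIter_mono hle' hi) (by nlinarith))
    · exact ⟨u, N - 1, 0, by rwa [Nat.sub_add_cancel hN0], rfl⟩
    · rintro w ⟨i, j, ⟨v, hv, hvw⟩, hj⟩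
      refine ⟨v, ⟨N - 1 + i, 1 + j, ?_, relIter_trans (relIter_one.2 hvw) hj⟩, hvw.1⟩
      rw [show N - 1 + i + 1 = N + i by omega]
      exact relIter_trans huu hv

end Chain

/-! ### Arc consistent families and walks through them. -/

section Instance

variable {I X : Type*}

/-- The projection of a set of assignments to two nodes. -/
def Proj (R : Set (I → X)) (i j : I) (a b : X) : Prop := ∃ r ∈ R, r i = a ∧ r j = b

theorem Proj.symm {R : Set (I → X)} {i j : I} {a b : X} (h : Proj R i j a b) : Proj R j i b a := by
  obtain ⟨r, hr, h1, h2⟩ := h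
  exact ⟨r, hr, h2, h1⟩

/-- `R` is closed under the operations `d 0, …, d n` applied coordinatewise. -/
def ClosedUnder (n : ℕ) (d : ℕ → X → X → X → X) (R : Set (I → X)) : Prop :=
  ∀ k ≤ n, ∀ f ∈ R, ∀ g ∈ R, ∀ h ∈ R, (fun i => d k (f i) (g i) (h i)) ∈ R

theorem ClosedUnder.proj {n : ℕ} {d : ℕ → X → X → X → X} {R : Set (I → X)}
    (hR : ClosedUnder n d R) (i j : I) : RelAbsorbs n d (Proj R i j) (Proj R i j) := by
  rintro k hk _ _ _ _ _ _ ⟨f, hf, rfl, rfl⟩ ⟨g, hg, rfl, rfl⟩ ⟨h, hh, rfl, rfl⟩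
  exact ⟨_, hR k hk f hf g hg h hh, rfl, rfl⟩

/-- Arc consistent families of subsets of the projections of `R`, absorbing them by means of `d`. -/
structure ArcConsistent (n : ℕ) (d : ℕ → X → X → X → X) (R : Set (I → X)) (adj : I → I → Prop)
    (P : I → Set X) : Prop where
  nonempty : ∀ i, (P i).Nonempty
  subset : ∀ i, ∀ a ∈ P i, ∃ r ∈ R, r i = a
  arc : ∀ i j, adj i j → ∀ a ∈ P i, ∃ b ∈ P j, Proj R i j a b
  absorbs : ∀ k ≤ n, ∀ i, ∀ a ∈ P i, ∀ c ∈ P i, ∀ r ∈ R, d k a (r i) c ∈ P i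

/-- The relation between the ends of a walk, realised inside `P` by projections of `R`. -/
def walkRel (R : Set (I → X)) (P : I → Set X) : I → List I → X → X → Prop
  | _, [], a, b => a = b
  | w, u :: l, a, b => ∃ c ∈ P u, Proj R w u a c ∧ walkRel R P u l c b

/-- The last node of a walk. -/
def walkEnd : I → List I → I
  | w, [] => w
  | _, u :: l => walkEnd u l

theorem walkEnd_append (w : I) (l l' : List I) :
    walkEnd w (l ++ l') = walkEnd (walkEnd w l) l' := by
  induction l generalizing w with
  | nil => rfl
  | cons u l ih => exact ih u

theorem walkRel_append {R : Set (I → X)} {P : I → Set X} {w : I} {l l' : List I} {a b : X} :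
    walkRel R P w (l ++ l') a b ↔ ∃ c, walkRel R P w l a c ∧ walkRel R P (walkEnd w l) l' c b := by
  induction l generalizing w a with
  | nil => simp [walkRel, walkEnd]
  | cons u l ih =>
    simp only [List.cons_append, walkRel, walkEnd, ih]
    constructor
    · rintro ⟨c, hc, h1, e, h2, h3⟩
      exact ⟨e, ⟨c, hc, h1, h2⟩, h3⟩
    · rintro ⟨e, ⟨c, hc, h1, h2⟩, h3⟩
      exact ⟨c, hc, h1, e, h2, h3⟩

theorem isChain_append {adj : I → I → Prop} {w : I} {l l' : List I}
    (h : List.IsChain adj (w :: l)) (h' : List.IsChain adj (walkEnd w l :: l')) :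
    List.IsChain adj (w :: (l ++ l')) := by
  induction l generalizing w with
  | nil => exact h'
  | cons u l ih =>
    rw [List.isChain_cons_cons] at h
    rw [List.cons_append, List.isChain_cons_cons]
    exact ⟨h.1, ih h.2 h'⟩

theorem walkRel_mem_end {R : Set (I → X)} {P : I → Set X} {w : I} {l : List I} {a b : X}
    (h : walkRel R P w l a b) (ha : a ∈ P w) : b ∈ P (walkEnd w l) := by
  induction l generalizing w a with
  | nil => exact (show a = b from h) ▸ ha
  | cons u l ih =>
    obtain ⟨c, hc, -, h2⟩ := h
    exact ih h2 hc

/-- Two solutions that agree somewhere on a walk can be spliced along it. -/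
theorem walkRel_splice {R : Set (I → X)} {w : I} {l : List I} {r r' : I → X} (hr : r ∈ R)
    (hr' : r' ∈ R) {u : I} (hu : u ∈ w :: l) (h : r u = r' u) :
    walkRel R (fun _ => Set.univ) w l (r w) (r' (walkEnd w l)) := by
  have follow : ∀ (l : List I) (w : I), walkRel R (fun _ => Set.univ) w l (r' w) (r' (walkEnd w l)) := by
    intro l
    induction l with
    | nil => exact fun w => rfl
    | cons v l ih => exact fun w => ⟨r' v, trivial, ⟨r', hr', rfl, rfl⟩, ih v⟩
  induction l generalizing w with
  | nil =>
    obtain rfl : u = w := by simpa using hu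
    exact h
  | cons v l ih =>
    rcases List.mem_cons.1 hu with rfl | hu
    · rw [h]
      exact follow _ _
    · exact ⟨r v, trivial, ⟨r, hr, rfl, rfl⟩, ih hu⟩

/-- Two solutions agree at some node of `vis`. -/
def Agree (R : Set (I → X)) (vis : Set I) (r r' : I → X) : Prop :=
  r ∈ R ∧ r' ∈ R ∧ ∃ u ∈ vis, r u = r' u

/-- Each edge of the walk is witnessed by a solution, and consecutive witnesses agree at the node
they share. -/
theorem exists_agree_of_walkRel {R : Set (I → X)} {P : I → Set X} {vis : Set I} {w : I}
    {l : List I} (hvis : ∀ u ∈ w :: l, u ∈ vis) {r : I → X} (hr : r ∈ R) {b : X}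
    (h : walkRel R P w l (r w) b) :
    ∃ r' ∈ R, r' (walkEnd w l) = b ∧ Relation.ReflTransGen (Agree R vis) r r' := by
  induction l generalizing w r with
  | nil => exact ⟨r, hr, h, .refl⟩
  | cons u l ih =>
    obtain ⟨c, -, ⟨r1, hr1, h1, rfl⟩, h3⟩ := h
    obtain ⟨r', hr', h4, h5⟩ := ih (fun v hv => hvis v (List.mem_cons_of_mem _ hv)) hr1 h3
    exact ⟨r', hr', h4, .head ⟨hr, hr1, w, hvis w (by simp), h1.symm⟩ h5⟩

variable {n : ℕ} {d : ℕ → X → X → X → X} {R : Set (I → X)} {adj : I → I → Prop} {P : I → Set X}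

/-- The middle walk need not stay in `P`: absorption by each `P u` puts the combined intermediate
values back into it. -/
theorem ArcConsistent.walk_absorbs (hP : ArcConsistent n d R adj P) (hR : ClosedUnder n d R)
    (w : I) (l : List I) :
    RelAbsorbs n d (walkRel R P w l) (walkRel R (fun _ => Set.univ) w l) := by
  induction l generalizing w with
  | nil =>
    rintro k - a _ b _ c _ rfl rfl rfl
    rfl
  | cons u l ih =>
    rintro k hk a a' b b' c c' ⟨x, hx, h1, h2⟩ ⟨y, -, h3, h4⟩ ⟨z, hz, h5, h6⟩
    refine ⟨d k x y z, ?_, hR.proj w u k hk _ _ _ _ _ _ h1 h3 h5, ih u k hk _ _ _ _ _ _ h2 h4 h6⟩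
    obtain ⟨r, hr, -, rfl⟩ := h3
    exact hP.absorbs k hk u x hx z hz r hr

theorem ArcConsistent.walk_succ (hP : ArcConsistent n d R adj P) {w : I} {l : List I}
    (hl : List.IsChain adj (w :: l)) {a : X} (ha : a ∈ P w) :
    ∃ b ∈ P (walkEnd w l), walkRel R P w l a b := by
  induction l generalizing w a with
  | nil => exact ⟨a, ha, rfl⟩
  | cons u l ih =>
    rw [List.isChain_cons_cons] at hl
    obtain ⟨c, hc, hac⟩ := hP.arc w u hl.1 a ha
    obtain ⟨b, hb, hcb⟩ := ih hl.2 hc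
    exact ⟨b, hb, c, hc, hac, hcb⟩

theorem ArcConsistent.walk_pred (hP : ArcConsistent n d R adj P)
    (hadj : ∀ i j, adj i j → adj j i) {w : I} {l : List I}
    (hl : List.IsChain adj (w :: l)) {b : X} (hb : b ∈ P (walkEnd w l)) :
    ∃ a ∈ P w, walkRel R P w l a b := by
  induction l generalizing w with
  | nil => exact ⟨b, hb, rfl⟩
  | cons u l ih =>
    rw [List.isChain_cons_cons] at hl
    obtain ⟨c, hc, hcb⟩ := ih hl.2 hb
    obtain ⟨a, ha, hca⟩ := hP.arc u w (hadj _ _ hl.1) c hc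
    exact ⟨a, ha, c, hc, hca.symm, hcb⟩

/-- A set that is carried to itself by a closed walk is carried into itself by each initial closed
subwalk. -/
theorem ArcConsistent.image_subset [Finite X] (hd : IsJonssonChain n d)
    (hP : ArcConsistent n d R adj P) (hR : ClosedUnder n d R) (hadj : ∀ i j, adj i j → adj j i)
    {w : I} {l l' : List I} (hl : List.IsChain adj (w :: l)) (hl' : List.IsChain adj (w :: l'))
    (hwl : walkEnd w l = w) (hwl' : walkEnd w l' = w) {Y Z : Set X} (hY : Y ⊆ P w)
    (hYZ : Z = {b | ∃ a ∈ Y, walkRel R P w l a b}) (hZY : Y = {b | ∃ a ∈ Z, walkRel R P w l' a b}) :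
    Z ⊆ Y := by
  intro b hb
  rw [hYZ] at hb
  obtain ⟨a, haY, hab⟩ := hb
  -- The composite closed walk maps `Y` into itself through `Z`, so it is enough to reach `b` from
  -- `a` by repeating it.
  have hU : List.IsChain adj (w :: (l ++ l')) := isChain_append hl (by rwa [hwl])
  have hUend : walkEnd w (l ++ l') = w := by rw [walkEnd_append, hwl, hwl']
  have hsub : ∀ u ∈ w :: l, u ∈ {u | u ∈ w :: (l ++ l')} := by
    intro u hu
    simp only [List.mem_cons, List.mem_append, Set.mem_ofPred_eq] at hu ⊢
    tauto
  set Q : X → X → Prop := fun x y =>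
    ∃ r r', Agree R {u | u ∈ w :: (l ++ l')} r r' ∧ r w = x ∧ r' w = y
  have lift : ∀ r r', Relation.ReflTransGen (Agree R {u | u ∈ w :: (l ++ l')}) r r' →
      Relation.ReflTransGen Q (r w) (r' w) := fun r r' h =>
    h.lift (fun r : I → X => r w) (fun r r' h => ⟨r, r', h, rfl, rfl⟩)
  have ha := hY haY
  have hbP : b ∈ P w := by
    have := walkRel_mem_end hab ha
    rwa [hwl] at this
  have hUabs := hP.walk_absorbs hR w (l ++ l')
  have habQ : Relation.ReflTransGen Q a b := by
    obtain ⟨r, hr, rfl⟩ := hP.subset w a ha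
    obtain ⟨r', -, h1, h2⟩ := exists_agree_of_walkRel hsub hr hab
    rw [hwl] at h1
    exact h1 ▸ lift _ _ h2
  have hreach := hd.reflTransGen_of_symmetric (Q := Q) hUabs (P := P w)
    (fun a ha => by simpa only [hUend] using hP.walk_succ hU ha)
    (fun b hb => hP.walk_pred hadj hU (by rwa [hUend]))
    (fun x y hxy hx => by
      obtain ⟨r, hr, rfl⟩ := hP.subset w x hx
      obtain ⟨r', -, h1, h2⟩ := exists_agree_of_walkRel (fun _ h => h) hr hxy
      rw [hUend] at h1
      exact h1 ▸ lift _ _ h2)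
    (by
      rintro _ _ ⟨r, r', ⟨hr, hr', u, hu, h⟩, rfl, rfl⟩
      exact ⟨r', r, ⟨hr', hr, u, hu, h.symm⟩, rfl, rfl⟩)
    (by
      rintro _ _ ⟨r, r', ⟨hr, hr', u, hu, h⟩, rfl, rfl⟩
      simpa only [hUend] using walkRel_splice hr hr' hu h)
    (by
      intro x hx
      obtain ⟨r, hr, rfl⟩ := hP.subset w x hx
      simpa only [hUend] using walkRel_splice hr hr (l := l ++ l') (List.mem_cons_self (a := w)) rfl)
    (fun x y hxy hx => by simpa only [hUend] using walkRel_mem_end hxy hx) ha hbP habQ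
  clear habQ hbP hab
  induction hreach with
  | refl => exact haY
  | tail _ h ih =>
    rw [walkRel_append] at h
    obtain ⟨c, h1, h2⟩ := h
    rw [hZY]
    refine ⟨c, ?_, by rwa [hwl] at h2⟩
    rw [hYZ]
    exact ⟨_, ih, h1⟩

end Instance

/-! ### Shrinking arc consistent families; solving the minimal ones. -/

section Minimal

variable {I X : Type*}

/-- Neighbours in `P j` of the elements of `Y ⊆ P i`. -/
def push (R : Set (I → X)) (P : I → Set X) (i j : I) (Y : Set X) : Set X :=
  {b | b ∈ P j ∧ ∃ a ∈ Y, Proj R i j a b}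

/-- One step of the propagation of proper subsets along the edges of the instance. -/
def PushStep (R : Set (I → X)) (adj : I → I → Prop) (P : I → Set X) (p q : I × Set X) : Prop :=
  adj p.1 q.1 ∧ q.2 = push R P p.1 q.1 p.2 ∧ q.2 ≠ P q.1

variable {n : ℕ} {d : ℕ → X → X → X → X} {R : Set (I → X)} {adj : I → I → Prop} {P : I → Set X}

/-- `Y` is a nonempty proper subset of `P i` that absorbs the projection of `R`. -/
structure ProperAbsorbing (n : ℕ) (d : ℕ → X → X → X → X) (R : Set (I → X)) (P : I → Set X)
    (p : I × Set X) : Prop where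
  nonempty : p.2.Nonempty
  subset : p.2 ⊆ P p.1
  ne : p.2 ≠ P p.1
  absorbs : ∀ k ≤ n, ∀ a ∈ p.2, ∀ c ∈ p.2, ∀ r ∈ R, d k a (r p.1) c ∈ p.2

theorem ProperAbsorbing.step (hP : ArcConsistent n d R adj P) (hR : ClosedUnder n d R)
    {p q : I × Set X} (hp : ProperAbsorbing n d R P p) (h : PushStep R adj P p q) :
    ProperAbsorbing n d R P q := by
  obtain ⟨i, Y⟩ := p
  obtain ⟨j, Z⟩ := q
  obtain ⟨hij, hZ, hne⟩ := h
  dsimp only at hij hZ hne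
  subst hZ
  refine ⟨?_, fun b hb => hb.1, hne, ?_⟩
  · obtain ⟨a, ha⟩ := hp.nonempty
    obtain ⟨b, hb, hab⟩ := hP.arc i j hij a (hp.subset ha)
    exact ⟨b, hb, a, ha, hab⟩
  · rintro k hk b ⟨hb, a, ha, hab⟩ c ⟨hc, e, he, hec⟩ r hr
    exact ⟨hP.absorbs k hk j b hb c hc r hr, d k a (r i) e, hp.absorbs k hk a ha e he r hr,
      hR.proj i j k hk _ _ _ _ _ _ hab ⟨r, hr, rfl, rfl⟩ hec⟩

theorem ProperAbsorbing.reach (hP : ArcConsistent n d R adj P) (hR : ClosedUnder n d R)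
    {p q : I × Set X} (hp : ProperAbsorbing n d R P p)
    (h : Relation.ReflTransGen (PushStep R adj P) p q) : ProperAbsorbing n d R P q := by
  induction h with
  | refl => exact hp
  | tail _ h ih => exact ih.step hP hR h

theorem exists_walk_of_reach {p q : I × Set X}
    (h : Relation.ReflTransGen (PushStep R adj P) p q) :
    ∃ l, List.IsChain adj (p.1 :: l) ∧ walkEnd p.1 l = q.1 ∧
      q.2 = {b | ∃ a ∈ p.2, walkRel R P p.1 l a b} := by
  induction h with
  | refl => exact ⟨[], by simp, rfl, by simp [walkRel]⟩
  | @tail q s _ h ih =>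
    obtain ⟨l, h1, h2, h3⟩ := ih
    obtain ⟨hadj, hs, -⟩ := h
    refine ⟨l ++ [s.1], isChain_append h1 ?_, ?_, ?_⟩
    · rw [h2]
      simpa using hadj
    · rw [walkEnd_append]
      rfl
    · rw [hs]
      ext b
      constructor
      · rintro ⟨hb, c, hc, hcb⟩
        rw [h3] at hc
        obtain ⟨a, ha, hac⟩ := hc
        exact ⟨a, ha, walkRel_append.2 ⟨c, hac, b, hb, by rwa [h2], rfl⟩⟩
      · rintro ⟨a, ha, hab⟩
        obtain ⟨c, hac, b', hb, hcb, rfl⟩ := walkRel_append.1 hab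
        rw [h2] at hcb
        exact ⟨hb, c, by rw [h3]; exact ⟨a, ha, hac⟩, hcb⟩

/-- In a finite set, every element reaches one that is reached back from everything it reaches. -/
theorem exists_reach_maximal {α : Type*} [Finite α] (S : α → α → Prop) (a : α) :
    ∃ b, Relation.ReflTransGen S a b ∧
      ∀ c, Relation.ReflTransGen S b c → Relation.ReflTransGen S c b := by
  induction hm : {c | Relation.ReflTransGen S a c}.ncard using Nat.strong_induction_on
    generalizing a with
  | _ m ih =>
  by_cases h : ∀ c, Relation.ReflTransGen S a c → Relation.ReflTransGen S c a
  · exact ⟨a, .refl, h⟩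
  · push Not at h
    obtain ⟨c, hac, hca⟩ := h
    have hlt : {x | Relation.ReflTransGen S c x} ⊂ {x | Relation.ReflTransGen S a x} :=
      ⟨fun x hx => hac.trans hx, fun hsub => hca (hsub (.refl : Relation.ReflTransGen S a a))⟩
    obtain ⟨b, hcb, hb⟩ := ih _ (hm ▸ Set.ncard_lt_ncard hlt) c rfl
    exact ⟨b, hac.trans hcb, hb⟩

/-- If some set of an arc consistent family has a nonempty proper absorbing subset, then there is a
smaller arc consistent family. -/
theorem ArcConsistent.exists_smaller [Finite I] [Finite X] (hd : IsJonssonChain n d)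
    (hP : ArcConsistent n d R adj P) (hR : ClosedUnder n d R) (hadj : ∀ i j, adj i j → adj j i)
    {p : I × Set X} (hp : ProperAbsorbing n d R P p) :
    ∃ P', ArcConsistent n d R adj P' ∧ (∀ i, P' i ⊆ P i) ∧ ∃ i, P' i ≠ P i := by
  -- In a terminal strong component of the propagation each node carries at most one set, since any
  -- two are carried to each other by closed walks. Cutting down to these sets gives the smaller
  -- family.
  obtain ⟨p0, hp0, hmax⟩ := exists_reach_maximal (PushStep R adj P) p
  have hpr : ∀ q, Relation.ReflTransGen (PushStep R adj P) p0 q → ProperAbsorbing n d R P q :=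
    fun q hq => hp.reach hP hR (hp0.trans hq)
  have huniq : ∀ i Y Z, Relation.ReflTransGen (PushStep R adj P) p0 (i, Y) →
      Relation.ReflTransGen (PushStep R adj P) p0 (i, Z) → Z ⊆ Y := by
    intro i Y Z hY hZ
    obtain ⟨l, h1, h2, h3⟩ := exists_walk_of_reach ((hmax _ hY).trans hZ)
    obtain ⟨l', h1', h2', h3'⟩ := exists_walk_of_reach ((hmax _ hZ).trans hY)
    exact hP.image_subset hd hR hadj h1 h1' h2 h2' (hpr _ hY).subset h3 h3'
  refine ⟨fun i => {a | a ∈ P i ∧ ∀ Y, Relation.ReflTransGen (PushStep R adj P) p0 (i, Y) → a ∈ Y},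
    ⟨?_, fun i a ha => hP.subset i a ha.1, ?_, ?_⟩, fun i a ha => ha.1, p0.1, ?_⟩
  · intro i
    by_cases h : ∃ Y, Relation.ReflTransGen (PushStep R adj P) p0 (i, Y)
    · obtain ⟨Y, hY⟩ := h
      obtain ⟨a, ha⟩ := (hpr _ hY).nonempty
      exact ⟨a, (hpr _ hY).subset ha, fun Z hZ => huniq i Z Y hZ hY ha⟩
    · obtain ⟨a, ha⟩ := hP.nonempty i
      exact ⟨a, ha, fun Y hY => absurd ⟨Y, hY⟩ h⟩
  · rintro i j hij a ⟨ha, haY⟩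
    by_cases h : ∃ Y, Relation.ReflTransGen (PushStep R adj P) p0 (j, Y)
    · obtain ⟨Y, hY⟩ := h
      have hmem : a ∈ push R P j i Y := by
        -- A push is either full, hence no restriction, or itself reached, hence contains `a`.
        by_cases hfull : push R P j i Y = P i
        · rwa [hfull]
        · exact haY _ (hY.tail ⟨hadj _ _ hij, rfl, hfull⟩)
      obtain ⟨-, b, hb, hba⟩ := hmem
      exact ⟨b, ⟨(hpr _ hY).subset hb, fun Z hZ => huniq j Z Y hZ hY hb⟩, hba.symm⟩
    · obtain ⟨b, hb, hab⟩ := hP.arc i j hij a ha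
      exact ⟨b, ⟨hb, fun Y hY => absurd ⟨Y, hY⟩ h⟩, hab⟩
  · rintro k hk i a ⟨ha, haY⟩ c ⟨hc, hcY⟩ r hr
    exact ⟨hP.absorbs k hk i a ha c hc r hr,
      fun Y hY => (hpr _ hY).absorbs k hk a (haY Y hY) c (hcY Y hY) r hr⟩
  · intro h
    refine (hpr p0 .refl).ne (Set.Subset.antisymm (hpr p0 .refl).subset fun a ha => ?_)
    rw [← h] at ha
    exact ha.2 _ .refl

/-- An arc consistent family without proper absorbing subsets contains an assignment that is
compatible along every edge. -/
theorem ArcConsistent.exists_assignment_of_minimal [Finite I] [Finite X] (hd : IsJonssonChain n d)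
    (hP : ArcConsistent n d R adj P) (hR : ClosedUnder n d R) (hadj : ∀ i j, adj i j → adj j i)
    (hmin : ∀ p, ¬ ProperAbsorbing n d R P p) (F : Finset (I × I)) (hF : ∀ e ∈ F, adj e.1 e.2) :
    ∃ g : I → X, (∀ i, g i ∈ P i) ∧ ∀ e ∈ F, Proj R e.1 e.2 (g e.1) (g e.2) := by
  classical
  induction F using Finset.induction_on with
  | empty =>
    choose g hg using hP.nonempty
    exact ⟨g, hg, by simp⟩
  | insert e F he ih =>
    obtain ⟨g0, hg0, hg0F⟩ := ih fun e' he' => hF e' (Finset.mem_insert_of_mem he')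
    obtain ⟨i, j⟩ := e
    have hij : adj i j := hF (i, j) (Finset.mem_insert_self _ _)
    set sat : (I → X) → Prop := fun g => ∀ e ∈ F, Proj R e.1 e.2 (g e.1) (g e.2)
    -- A loop of `S` is an assignment that respects the new edge too. `T` relaxes `P` to the
    -- projections of `R`; elements of `R` make it reflexive there.
    set S : X → X → Prop := fun a b =>
      ∃ g, (∀ i, g i ∈ P i) ∧ sat g ∧ g i = a ∧ b ∈ P i ∧ Proj R i j b (g j)
    set T : X → X → Prop := fun a b =>
      ∃ g, (∀ i, ∃ r ∈ R, r i = g i) ∧ sat g ∧ g i = a ∧ (∃ r ∈ R, r i = b) ∧ Proj R i j b (g j)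
    have comb : ∀ k ≤ n, ∀ f g h, sat f → sat g → sat h → sat fun i => d k (f i) (g i) (h i) :=
      fun k hk f g h hf hg hh e he =>
        hR.proj e.1 e.2 k hk _ _ _ _ _ _ (hf e he) (hg e he) (hh e he)
    have absP : ∀ k ≤ n, ∀ i, ∀ a ∈ P i, ∀ b, (∃ r ∈ R, r i = b) → ∀ c ∈ P i, d k a b c ∈ P i := by
      rintro k hk i a ha _ ⟨r, hr, rfl⟩ c hc
      exact hP.absorbs k hk i a ha c hc r hr
    have hST : RelAbsorbs n d S T := by
      rintro k hk _ a' _ b' _ c' ⟨f, hf, hfs, rfl, ha', hfa⟩ ⟨g, hg, hgs, rfl, hb', hgb⟩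
        ⟨h, hh, hhs, rfl, hc', hhc⟩
      exact ⟨_, fun u => absP k hk u _ (hf u) _ (hg u) _ (hh u), comb k hk f g h hfs hgs hhs, rfl,
        absP k hk i _ ha' _ hb' _ hc', hR.proj i j k hk _ _ _ _ _ _ hfa hgb hhc⟩
    have hle : ∀ a b, S a b → T a b := by
      rintro _ b ⟨g, hg, hgs, rfl, hb, hgb⟩
      exact ⟨g, fun u => hP.subset u _ (hg u), hgs, rfl, hP.subset i b hb, hgb⟩
    -- The second projection of `S` is nonempty and absorbing, so it cannot be a proper subset.
    have hpred : {b | ∃ a, S a b} = P i := by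
      by_contra hne
      refine hmin (i, {b | ∃ a, S a b}) ⟨?_, ?_, hne, ?_⟩
      · obtain ⟨b, hb, hgb⟩ := hP.arc j i (hadj _ _ hij) _ (hg0 j)
        exact ⟨b, _, g0, hg0, hg0F, rfl, hb, hgb.symm⟩
      · rintro b ⟨a, g, -, -, -, hb, -⟩
        exact hb
      · rintro k hk b ⟨a, hab⟩ c ⟨a', hac⟩ r hr
        exact ⟨_, hST k hk _ _ (r i) (r i) _ _ hab
          ⟨r, fun u => ⟨r, hr, rfl⟩, fun e _ => ⟨r, hr, rfl, rfl⟩, rfl, ⟨r, hr, rfl⟩,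
            r, hr, rfl, rfl⟩ hac⟩
    obtain ⟨a, g, hg, hgs, rfl, -, hga⟩ := hd.exists_loop hST hle (P := P i) (C := P i)
      (fun a ha => by
        obtain ⟨r, hr, rfl⟩ := hP.subset i a ha
        exact ⟨r, fun u => ⟨r, hr, rfl⟩, fun e _ => ⟨r, hr, rfl, rfl⟩, rfl, ⟨r, hr, rfl⟩,
            r, hr, rfl, rfl⟩)
      (fun k hk a ha b hb c hc => absP k hk i a ha b (hP.subset i b hb) c hc) subset_rfl
      (hP.nonempty i)
      (fun b hb => by
        rw [← hpred] at hb
        obtain ⟨a, hab⟩ := hb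
        obtain ⟨g, hg, -, hga, -⟩ := id hab
        exact ⟨a, hga ▸ hg i, hab⟩)
    refine ⟨g, hg, fun e he => ?_⟩
    rcases Finset.mem_insert.1 he with rfl | he
    · exact hga
    · exact hgs e he

/-- Every arc consistent family contains an assignment compatible along every edge. -/
theorem ArcConsistent.exists_assignment [Finite I] [Finite X] (hd : IsJonssonChain n d)
    (hP : ArcConsistent n d R adj P) (hR : ClosedUnder n d R)
    (hadj : ∀ i j, adj i j → adj j i) :
    ∃ g : I → X, (∀ i, g i ∈ P i) ∧ ∀ i j, adj i j → Proj R i j (g i) (g j) := by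
  classical
  obtain ⟨Q, ⟨hQ, hQP⟩, hQmin⟩ := (Set.toFinite
    {Q : I → Set X | ArcConsistent n d R adj Q ∧ Q ≤ P}).exists_minimal ⟨P, hP, le_rfl⟩
  have := Fintype.ofFinite I
  obtain ⟨g, hg, hgF⟩ := hQ.exists_assignment_of_minimal hd hR hadj
    (fun p hp => by
      obtain ⟨Q', hQ', hsub, i, hi⟩ := hQ.exists_smaller hd hR hadj hp
      exact hi (Set.Subset.antisymm (hsub i) (hQmin ⟨hQ', le_trans hsub hQP⟩ hsub i)))
    (Finset.univ.filter fun e : I × I => adj e.1 e.2) (by simp)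
  exact ⟨g, fun i => hQP i (hg i), fun i j hij => hgF (i, j) (by simpa using hij)⟩

end Minimal

/-! ### Tree instances and the leaf bound for critical trees. -/

section Trees

variable {V A : Type*}

/-- Rooted tree instances over the set `V` of variables: the root is a variable, and below a `θ`-ary
constraint with scope `s` hang trees rooted at the variables of the scope. The leaves are
unconstrained (`top`) or, for variables in `W`, constrained to a fixed unary relation (`leaf`). -/
inductive Tree (θ : ℕ) (W : Set V) : V → Type _
  | top (v : V) : Tree θ W v
  | leaf (v : V) (hv : v ∈ W) : Tree θ W v
  | step (s : Fin θ → V) (i : Fin θ) (ch : ∀ j, Tree θ W (s j)) : Tree θ W (s i)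

variable {θ : ℕ} {W : Set V}

/-- The values of the root in the solutions of a tree instance, whose constraints are projections of
`R` and whose leaves are constrained to `B`. -/
def Tree.val (R : Set (V → A)) (B : Set A) : ∀ {v : V}, Tree θ W v → Set A
  | _, .top v => {a | ∃ f ∈ R, f v = a}
  | _, .leaf v _ => {a | (∃ f ∈ R, f v = a) ∧ a ∈ B}
  | _, .step s i ch => {a | ∃ f ∈ R, (∀ j, f (s j) ∈ (ch j).val R B) ∧ f (s i) = a}

/-- The number of constrained leaves. -/
def Tree.leafCount : ∀ {v : V}, Tree θ W v → ℕ
  | _, .top _ => 0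
  | _, .leaf _ _ => 1
  | _, .step _ _ ch => ∑ j, (ch j).leafCount

/-- The labels of the constrained leaves. -/
def Tree.labels {ι : Type*} [DecidableEq ι] (bad : V → ι) : ∀ {v : V}, Tree θ W v → Finset ι
  | _, .top _ => ∅
  | _, .leaf v _ => {bad v}
  | _, .step _ _ ch => Finset.univ.biUnion fun j => (ch j).labels bad

variable {R : Set (V → A)} {B : Set A}

theorem Tree.card_labels_le {ι : Type*} [DecidableEq ι] (bad : V → ι) {v : V} (t : Tree θ W v) :
    (t.labels bad).card ≤ t.leafCount := by
  induction t with
  | top v => simp [labels]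
  | leaf v hv => simp [labels, leafCount]
  | step s i ch ih =>
    exact Finset.card_biUnion_le.trans (Finset.sum_le_sum fun j _ => ih j)

theorem Tree.mem_val_of_labels {ι : Type*} [DecidableEq ι] (bad : V → ι) {f : V → A} (hf : f ∈ R)
    {v : V} (t : Tree θ W v) (h : ∀ w ∈ W, bad w ∈ t.labels bad → f w ∈ B) : f v ∈ t.val R B := by
  induction t with
  | top v => exact ⟨f, hf, rfl⟩
  | leaf v hv => exact ⟨⟨f, hf, rfl⟩, h v hv (by simp [labels])⟩
  | step s i ch ih =>
    refine ⟨f, hf, fun j => ih j fun w hw hb => h w hw ?_, rfl⟩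
    exact Finset.mem_biUnion.2 ⟨j, Finset.mem_univ _, hb⟩

/-- A tree with fewer constrained leaves than there are labels is satisfiable. -/
theorem Tree.val_nonempty_of_leafCount_lt {ι : Type*} [Fintype ι] (bad : V → ι)
    (hbad : ∀ i, ∃ f ∈ R, ∀ w ∈ W, bad w ≠ i → f w ∈ B) {v : V} (t : Tree θ W v)
    (ht : t.leafCount < Fintype.card ι) : (t.val R B).Nonempty := by
  classical
  obtain ⟨i, hi⟩ : ∃ i, i ∉ t.labels bad := by
    by_contra! h
    have := t.card_labels_le bad
    rw [(Finset.eq_univ_iff_forall.2 h), Finset.card_univ] at this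
    omega
  obtain ⟨f, hf, hfB⟩ := hbad i
  exact ⟨f v, t.mem_val_of_labels bad hf fun w hw hb => hfB w hw fun h => hi (h ▸ hb)⟩

variable {n : ℕ} {d : ℕ → A → A → A → A}

theorem Tree.val_absorbs (hR : ClosedUnder n d R)
    (hB : ∀ k ≤ n, ∀ a ∈ B, ∀ b, ∀ c ∈ B, d k a b c ∈ B) {v : V} (t : Tree θ W v) :
    ∀ k ≤ n, ∀ a ∈ t.val R B, ∀ c ∈ t.val R B, ∀ r ∈ R, d k a (r v) c ∈ t.val R B := by
  induction t with
  | top v =>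
    rintro k hk _ ⟨f, hf, rfl⟩ _ ⟨g, hg, rfl⟩ r hr
    exact ⟨_, hR k hk f hf r hr g hg, rfl⟩
  | leaf v hv =>
    rintro k hk _ ⟨⟨f, hf, rfl⟩, hfB⟩ _ ⟨⟨g, hg, rfl⟩, hgB⟩ r hr
    exact ⟨⟨_, hR k hk f hf r hr g hg, rfl⟩, hB k hk _ hfB _ _ hgB⟩
  | step s i ch ih =>
    rintro k hk _ ⟨f, hf, hfc, rfl⟩ _ ⟨g, hg, hgc, rfl⟩ r hr
    exact ⟨_, hR k hk f hf r hr g hg, fun j => ih j k hk _ (hfc j) _ (hgc j) r hr, rfl⟩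

/-- The pair `p` of a value set and a context set at some place of a tree is linked to the pair
`(C, E)` at a deeper place through the part of the tree in between. -/
def Linked (n : ℕ) (d : ℕ → A → A → A → A) (p : Set A × Set A) (C E : Set A) : Prop :=
  ∃ S T : A → A → Prop, RelAbsorbs n d S T ∧ (∀ a b, S a b → T a b) ∧
    (∀ b ∈ p.1, ∃ a ∈ C, S a b) ∧ (∀ a ∈ C, ∀ b, S a b → b ∈ p.1) ∧
    (∀ a ∈ E, ∃ b ∈ p.2, S a b) ∧ ∃ c ∈ C, ∃ e ∈ p.2, T c e

/-- A disjoint pair therefore cannot recur deeper along a link. -/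
theorem Linked.not_disjoint [Finite A] (hd : IsJonssonChain n d) {C E : Set A}
    (h : Linked n d (C, E) C E) : ∃ a, a ∈ C ∧ a ∈ E := by
  obtain ⟨S, T, hST, hle, h1, h2, h3, c, hc, e, he, hce⟩ := h
  exact hd.separation hST hle h1 h2 h3 hc he hce

/-- The relation between the value at the child `j` of a constraint and the value at its root. -/
def childRel (R : Set (V → A)) (s : Fin θ → V) (i j : Fin θ) (val : Fin θ → Set A) (b a : A) : Prop :=
  ∃ f ∈ R, f (s j) = b ∧ f (s i) = a ∧ ∀ l, l ≠ j → f (s l) ∈ val l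

theorem childRel_absorbs (hR : ClosedUnder n d R) {s : Fin θ → V} {i j : Fin θ}
    {val : Fin θ → Set A}
    (hval : ∀ l, ∀ k ≤ n, ∀ a ∈ val l, ∀ c ∈ val l, ∀ r ∈ R, d k a (r (s l)) c ∈ val l) :
    RelAbsorbs n d (childRel R s i j val) (Proj R (s j) (s i)) := by
  rintro k hk _ _ _ _ _ _ ⟨f, hf, rfl, rfl, hfv⟩ ⟨r, hr, rfl, rfl⟩ ⟨g, hg, rfl, rfl, hgv⟩
  exact ⟨_, hR k hk f hf r hr g hg, rfl, rfl, fun l hl => hval l k hk _ (hfv l hl) _ (hgv l hl) r hr⟩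

/-- A disjoint pair is a three-valued map: first set, second set, neither. -/
theorem card_disjoint_pairs_le [Fintype A] (U : Finset (Set A × Set A))
    (hU : ∀ p ∈ U, ∀ a ∈ p.1, a ∉ p.2) : U.card ≤ 3 ^ Fintype.card A := by
  classical
  have h := Finset.card_le_card_of_injOn (s := U) (t := (Finset.univ : Finset (A → Fin 3)))
    (fun p a => if a ∈ p.1 then 0 else if a ∈ p.2 then 1 else 2) (by simp) (by
      intro p hp q hq hpq
      have key : ∀ a, (a ∈ p.1 ↔ a ∈ q.1) ∧ (a ∈ p.2 ↔ a ∈ q.2) := by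
        intro a
        have h := congrFun hpq a
        have h1 := hU p hp a
        have h2 := hU q hq a
        dsimp only at h
        split_ifs at h <;> simp_all
      exact Prod.ext (Set.ext fun a => (key a).1) (Set.ext fun a => (key a).2))
  simpa using h

/-- The number of constrained leaves of a subtree that is critical in its context `E`, given a set `U`
of pairs to which its own pair is linked. -/
theorem Tree.leafCount_le_of_critical [Fintype A] (hθ : 2 ≤ θ) (hd : IsJonssonChain n d)
    (hR : ClosedUnder n d R) (hB : ∀ k ≤ n, ∀ a ∈ B, ∀ b, ∀ c ∈ B, d k a b c ∈ B) {v : V}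
    (t : Tree θ W v) (E : Set A) (hdisj : ∀ a ∈ t.val R B, a ∉ E)
    (hcrit : ∀ t' : Tree θ W v, t'.leafCount < t.leafCount → ∃ a ∈ t'.val R B, a ∈ E)
    (U : Finset (Set A × Set A)) (hU : ∀ p ∈ U, Linked n d p (t.val R B) E)
    (hUdisj : ∀ p ∈ U, ∀ a ∈ p.1, a ∉ p.2) :
    t.leafCount ≤ θ ^ (3 ^ Fintype.card A - 1 - U.card) := by
  classical
  induction t generalizing E U with
  | top v => simp [leafCount]
  | leaf v hv => exact Nat.one_le_pow _ _ (by omega)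
  | step s i ch ih =>
    set t : Tree θ W (s i) := .step s i ch with ht
    set S : Fin θ → A → A → Prop := fun j => childRel R s i j fun l => (ch l).val R B with hS
    set E' : Fin θ → Set A := fun j => {b | ∃ a ∈ E, S j b a} with hE'
    have hcount : t.leafCount = ∑ j, (ch j).leafCount := rfl
    have hSval : ∀ j, ∀ a ∈ (ch j).val R B, ∀ b, S j a b → b ∈ t.val R B := by
      rintro j _ ha _ ⟨f, hf, rfl, rfl, h⟩
      refine ⟨f, hf, fun l => ?_, rfl⟩
      by_cases hl : l = j
      · exact hl ▸ ha
      · exact h l hl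
    have hSval' : ∀ j, ∀ b ∈ t.val R B, ∃ a ∈ (ch j).val R B, S j a b := by
      rintro j _ ⟨f, hf, h, rfl⟩
      exact ⟨f (s j), h j, f, hf, rfl, rfl, fun l _ => h l⟩
    have hSle : ∀ j a b, S j a b → Proj R (s j) (s i) a b := by
      rintro j _ _ ⟨f, hf, h1, h2, -⟩
      exact ⟨f, hf, h1, h2⟩
    have hSabs : ∀ j, RelAbsorbs n d (S j) (Proj R (s j) (s i)) := fun j =>
      childRel_absorbs hR fun l => (ch l).val_absorbs hR hB
    have hdisj' : ∀ j, ∀ a ∈ (ch j).val R B, a ∉ E' j := by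
      rintro j a ha ⟨b, hb, hab⟩
      exact hdisj b (hSval j a ha b hab) hb
    have hcrit' : ∀ j, ∀ t' : Tree θ W (s j), t'.leafCount < (ch j).leafCount →
        ∃ a ∈ t'.val R B, a ∈ E' j := by
      intro j t' ht'
      have hlt : (Tree.step s i (Function.update ch j t')).leafCount < t.leafCount := by
        rw [hcount]
        refine Finset.sum_lt_sum (fun l _ => ?_) ⟨j, Finset.mem_univ _, by simpa using ht'⟩
        by_cases hl : l = j
        · subst hl
          simpa using ht'.le
        · rw [Function.update_of_ne hl]
      obtain ⟨_, ⟨f, hf, h, rfl⟩, hE⟩ := hcrit _ hlt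
      refine ⟨f (s j), by simpa using h j, f (s i), hE, f, hf, rfl, rfl, fun l hl => ?_⟩
      have := h l
      rwa [Function.update_of_ne hl] at this
    have hlink : ∀ j, ∀ p ∈ U, Linked n d p ((ch j).val R B) (E' j) := by
      intro j p hp
      obtain ⟨S', T', hST, hle, h1, h2, h3, c, hc, e, he, hce⟩ := hU p hp
      refine ⟨_, _, (hSabs j).comp hST, ?_, ?_, ?_, ?_, ?_⟩
      · rintro a b ⟨x, hx, hxb⟩
        exact ⟨x, hSle j _ _ hx, hle _ _ hxb⟩
      · intro b hb
        obtain ⟨x, hx, hxb⟩ := h1 b hb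
        obtain ⟨a, ha, hax⟩ := hSval' j x hx
        exact ⟨a, ha, x, hax, hxb⟩
      · rintro a ha b ⟨x, hax, hxb⟩
        exact h2 x (hSval j a ha x hax) b hxb
      · rintro a ⟨x, hx, hax⟩
        obtain ⟨b, hb, hxb⟩ := h3 x hx
        exact ⟨b, hb, x, hax, hxb⟩
      · obtain ⟨a, ha, hac⟩ := hSval' j c hc
        exact ⟨a, ha, e, he, c, hSle j _ _ hac, hce⟩
    -- A child keeping all the leaves simply replaces the tree; a pair is recorded only where every
    -- child has fewer.
    by_cases hdrop : ∃ j, (ch j).leafCount = t.leafCount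
    · obtain ⟨j, hj⟩ := hdrop
      rw [← hj]
      exact ih j (E' j) (hdisj' j) (hcrit' j) U (hlink j) hUdisj
    · push Not at hdrop
      have hlt : ∀ j, (ch j).leafCount < t.leafCount := fun j =>
        lt_of_le_of_ne (Finset.single_le_sum (f := fun j => (ch j).leafCount)
          (fun _ _ => Nat.zero_le _) (Finset.mem_univ j)) (hdrop j)
      set p : Set A × Set A := (t.val R B, E) with hp
      have hpU : p ∉ U := fun h => by
        obtain ⟨a, h1, h2⟩ := (hU p h).not_disjoint hd
        exact hdisj a h1 h2
      have hlink' : ∀ j, ∀ q ∈ insert p U, Linked n d q ((ch j).val R B) (E' j) := by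
        intro j q hq
        rcases Finset.mem_insert.1 hq with rfl | hq
        · refine ⟨_, _, hSabs j, hSle j, hSval' j, hSval j, fun a ha => ha, ?_⟩
          -- Freeing the siblings of `j` leaves fewer leaves than `t` has, so criticality yields the
          -- required `T`-edge from the child's values into `E`. This is why pairs are recorded only
          -- at drops.
          have hlt' : (Tree.step s i
              (Function.update (fun l => Tree.top (s l)) j (ch j))).leafCount < t.leafCount := by
            refine lt_of_le_of_lt (le_of_eq ?_) (hlt j)
            rw [leafCount, Finset.sum_eq_single j]
            · simp
            · intro l _ hl
              rw [Function.update_of_ne hl]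
              rfl
            · simp
          obtain ⟨_, ⟨f, hf, h, rfl⟩, hE⟩ := hcrit _ hlt'
          exact ⟨f (s j), by simpa using h j, f (s i), hE, f, hf, rfl, rfl⟩
        · exact hlink j q hq
      have hdisj'' : ∀ q ∈ insert p U, ∀ a ∈ q.1, a ∉ q.2 := by
        intro q hq
        rcases Finset.mem_insert.1 hq with rfl | hq
        · exact hdisj
        · exact hUdisj q hq
      have hcard : (insert p U).card = U.card + 1 := Finset.card_insert_of_notMem hpU
      have hchild : ∀ j, (ch j).leafCount ≤ θ ^ (3 ^ Fintype.card A - 1 - (U.card + 1)) := by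
        intro j
        rw [← hcard]
        exact ih j (E' j) (hdisj' j) (hcrit' j) _ (hlink' j) hdisj''
      -- A child's pair is one more disjoint pair, so the truncated subtraction in the exponent
      -- really decreases by one.
      have hroom : U.card + 2 ≤ 3 ^ Fintype.card A := by
        have j : Fin θ := ⟨0, by omega⟩
        have hq : ((ch j).val R B, E' j) ∉ insert p U := fun h => by
          obtain ⟨a, h1, h2⟩ := (hlink' j _ h).not_disjoint hd
          exact hdisj' j a h1 h2
        have := card_disjoint_pairs_le (insert ((ch j).val R B, E' j) (insert p U)) (by
          intro q hq
          rcases Finset.mem_insert.1 hq with rfl | hq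
          · exact hdisj' j
          · exact hdisj'' q hq)
        rwa [Finset.card_insert_of_notMem hq, hcard] at this
      calc t.leafCount ≤ ∑ _j : Fin θ, θ ^ (3 ^ Fintype.card A - 1 - (U.card + 1)) :=
            Finset.sum_le_sum fun j _ => hchild j
        _ = θ ^ (3 ^ Fintype.card A - 1 - U.card) := by
            rw [Finset.sum_const, Finset.card_univ, Fintype.card_fin, smul_eq_mul, ← pow_succ']
            congr 1
            omega

/-- If all trees with few constrained leaves are satisfiable, then so are all trees. -/
theorem Tree.val_nonempty [Fintype A] (hθ : 2 ≤ θ) (hd : IsJonssonChain n d)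
    (hR : ClosedUnder n d R) (hB : ∀ k ≤ n, ∀ a ∈ B, ∀ b, ∀ c ∈ B, d k a b c ∈ B) {m : ℕ}
    (hm : θ ^ (3 ^ Fintype.card A - 1) < m) {v : V}
    (hsmall : ∀ t : Tree θ W v, t.leafCount < m → (t.val R B).Nonempty) (t : Tree θ W v) :
    (t.val R B).Nonempty := by
  induction hc : t.leafCount using Nat.strong_induction_on generalizing t with
  | _ c ih =>
  subst hc
  by_contra hne
  have h := t.leafCount_le_of_critical hθ hd hR hB Set.univ (fun a ha _ => hne ⟨a, ha⟩)
    (fun t' ht' => by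
      obtain ⟨a, ha⟩ := ih _ ht' t' rfl
      exact ⟨a, ha, trivial⟩) ∅ (by simp) (by simp)
  exact hne (hsmall t (lt_of_le_of_lt (by simpa using h) hm))

/-- The values admitted by all trees are the values of a single tree. -/
theorem Tree.exists_least [Finite A] (hθ : 2 ≤ θ) (v : V) :
    ∃ t : Tree θ W v, ∀ t' : Tree θ W v, t.val R B ⊆ t'.val R B := by
  classical
  obtain ⟨t, -, ht⟩ := WellFounded.has_min
    (measure fun t : Tree θ W v => (t.val R B).ncard).wf Set.univ ⟨.top v, trivial⟩
  refine ⟨t, fun t' => ?_⟩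
  set i0 : Fin θ := ⟨0, by omega⟩
  set i1 : Fin θ := ⟨1, by omega⟩
  have h01 : i1 ≠ i0 := by simp [i0, i1]
  -- A scope that repeats `v` makes both subtrees share the root value, so the values of `u` lie in
  -- both value sets.
  set u : Tree θ W v := .step (fun _ => v) i0 fun j => if j = i0 then t else t'
  have hu : ∀ a ∈ u.val R B, a ∈ t.val R B ∧ a ∈ t'.val R B := by
    rintro _ ⟨f, hf, h, rfl⟩
    have h0 := h i0
    have h1 := h i1
    dsimp only at h0 h1
    rw [if_pos rfl] at h0
    rw [if_neg h01] at h1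
    exact ⟨h0, h1⟩
  have heq : u.val R B = t.val R B :=
    Set.eq_of_subset_of_ncard_le (fun a ha => (hu a ha).1) (not_lt.1 (ht u trivial))
  rw [← heq]
  exact fun a ha => (hu a ha).2

/-- Local-to-global principle: if `R` is determined by its `θ`-ary projections and `B` is Jónsson
absorbing, then `R` has an element with all coordinates in `W` in `B` provided that the
coordinates in `W` may be labelled by many labels in such a way that each single label can be avoided. -/
theorem exists_solution [Finite V] [Fintype A] (hθ : 2 ≤ θ) (hd : IsJonssonChain n d)
    (hR : ClosedUnder n d R) (hB : ∀ k ≤ n, ∀ a ∈ B, ∀ b, ∀ c ∈ B, d k a b c ∈ B)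
    (hloc : ∀ f : V → A, (∀ s : Fin θ → V, ∃ r ∈ R, ∀ j, r (s j) = f (s j)) → f ∈ R)
    {ι : Type*} [Fintype ι] (bad : V → ι) (hbad : ∀ i, ∃ f ∈ R, ∀ w ∈ W, bad w ≠ i → f w ∈ B)
    (hι : θ ^ (3 ^ Fintype.card A - 1) < Fintype.card ι) :
    ∃ f ∈ R, ∀ w ∈ W, f w ∈ B := by
  classical
  choose least hleast using fun v : V => Tree.exists_least (W := W) (R := R) (B := B) hθ v
  have hne : ∀ {v : V} (t : Tree θ W v), (t.val R B).Nonempty := fun t =>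
    t.val_nonempty hθ hd hR hB hι fun t' ht' => t'.val_nonempty_of_leafCount_lt bad hbad ht'
  set i0 : Fin θ := ⟨0, by omega⟩
  -- Constraints become binary: the nodes are `θ`-tuples of variables, and a tuple is joined to the
  -- constant tuples of its entries, which stand for single variables.
  set R' : Set ((Fin θ → V) → (Fin θ → A)) := {F | ∃ f ∈ R, ∀ s, F s = f ∘ s} with hR'
  set d' : ℕ → (Fin θ → A) → (Fin θ → A) → (Fin θ → A) → (Fin θ → A) :=
    fun k x y z j => d k (x j) (y j) (z j) with hd'
  set adj : (Fin θ → V) → (Fin θ → V) → Prop :=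
    fun s t => (∃ j, t = fun _ => s j) ∨ ∃ j, s = fun _ => t j with hadj
  set P : (Fin θ → V) → Set (Fin θ → A) :=
    fun s => {x | ∃ f ∈ R, x = f ∘ s ∧ ∀ j, f (s j) ∈ (least (s j)).val R B} with hP
  have hproj : ∀ f ∈ R, ∀ s t, Proj R' s t (f ∘ s) (f ∘ t) := fun f hf s t =>
    ⟨fun s => f ∘ s, ⟨f, hf, fun _ => rfl⟩, rfl, rfl⟩
  have hchain : IsJonssonChain n d' :=
    ⟨fun x y z => funext fun j => hd.first _ _ _, fun x y z => funext fun j => hd.last _ _ _,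
      fun i hi x y => funext fun j => hd.link i hi _ _⟩
  have hclosed : ClosedUnder n d' R' := by
    rintro k hk F ⟨f, hf, hF⟩ G ⟨g, hg, hG⟩ H ⟨h, hh, hH⟩
    refine ⟨_, hR k hk f hf g hg h hh, fun s => ?_⟩
    simp only [hF, hG, hH]
    rfl
  have hAC : ArcConsistent n d' R' adj P := by
    refine ⟨fun s => ?_, ?_, ?_, ?_⟩
    · obtain ⟨_, f, hf, h, -⟩ := hne (Tree.step s i0 fun j => least (s j))
      exact ⟨f ∘ s, f, hf, rfl, h⟩
    · rintro s _ ⟨f, hf, rfl, -⟩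
      exact ⟨fun s => f ∘ s, ⟨f, hf, fun _ => rfl⟩, rfl⟩
    · rintro s t (⟨j, rfl⟩ | ⟨j, rfl⟩) _ ⟨f, hf, rfl, hval⟩
      · exact ⟨f ∘ fun _ => s j, ⟨f, hf, rfl, fun _ => hval j⟩, hproj f hf _ _⟩
      -- The tree formed by the scope `t` over the least trees cannot exclude a value of the least
      -- tree at `t j`.
      · obtain ⟨g, hg, hgval, hgj⟩ := hleast (t j) (.step t j fun l => least (t l)) (hval i0)
        refine ⟨g ∘ t, ⟨g, hg, rfl, hgval⟩, ?_⟩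
        have : (f ∘ fun _ : Fin θ => t j) = g ∘ fun _ => t j := funext fun _ => hgj.symm
        rw [this]
        exact hproj g hg _ _
    · rintro k hk s _ ⟨f, hf, rfl, hfv⟩ _ ⟨g, hg, rfl, hgv⟩ F ⟨r, hr, hF⟩
      refine ⟨_, hR k hk f hf r hr g hg, ?_,
        fun j => (least (s j)).val_absorbs hR hB k hk _ (hfv j) _ (hgv j) r hr⟩
      rw [hF]
      rfl
  obtain ⟨G, hG, hGadj⟩ := hAC.exists_assignment hchain hclosed (fun s t h => h.symm)
  set f : V → A := fun v => G (fun _ => v) i0 with hf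
  have hGf : ∀ s, G s = f ∘ s := by
    intro s
    funext j
    obtain ⟨F, ⟨r, -, hF⟩, h1, h2⟩ := hGadj s (fun _ => s j) (Or.inl ⟨j, rfl⟩)
    rw [hf, ← h1, Function.comp_apply, ← h2, hF, hF]
    rfl
  refine ⟨f, hloc f fun s => ?_, fun w hw => ?_⟩
  · obtain ⟨r, hr, h, -⟩ := hG s
    exact ⟨r, hr, fun j => by rw [← Function.comp_apply (f := f), ← hGf, h]; rfl⟩
  · obtain ⟨r, hr, h, hval⟩ := hG fun _ => w
    have h1 := (hleast w (.leaf w hw) (hval i0)).2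
    have h2 : f w = r w := by rw [hf]; exact congrFun h i0
    rwa [h2]

end Trees

/-! ### Polymorphisms as solutions, and the theorem. -/

open Absorption FirstOrder

section Polymorphisms

variable {L : Language} {A : Type*} [L.Structure A] {m : ℕ}

theorem isPolymorphism_proj (i : Fin m) : IsPolymorphism L fun x : Fin m → A => x i :=
  fun _ _ _ hM => hM i

theorem isPolymorphism_realize {α : Type*} (t : (Pol L A).Term α) {v : α → (Fin m → A) → A}
    (hv : ∀ a, IsPolymorphism L (v a)) :
    IsPolymorphism L fun x => t.realize fun a => v a x := by
  induction t with
  | var a => exact hv a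
  | func F ts ih => exact fun k S M hM => F.2.2 S _ fun i => ih i S M hM

/-- Preservation of relations of arity at most `θ` can be checked on sets of `θ` columns. -/
theorem isPolymorphism_of_local {θ : ℕ} (h_arity : ∀ k : ℕ, Nonempty (L.Relations k) → k ≤ θ)
    (hm : 0 < m) {f : (Fin m → A) → A}
    (hf : ∀ s : Fin θ → Fin m → A, ∃ r, IsPolymorphism L r ∧ ∀ j, r (s j) = f (s j)) :
    IsPolymorphism L f := by
  intro k S M hM
  have hk := h_arity k ⟨S⟩
  rcases Nat.eq_zero_or_pos k with rfl | hk0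
  -- A nullary relation already holds of any row, and `0 < m` provides one.
  · have heq : M ⟨0, hm⟩ = fun j => f fun i => M i j := Subsingleton.elim _ _
    exact heq ▸ hM ⟨0, hm⟩
  -- The `k` columns are padded to `θ` by repeating column 0.
  · obtain ⟨r, hr, hrf⟩ := hf fun j i => M i (if h : j.1 < k then ⟨j, h⟩ else ⟨0, hk0⟩)
    have heq : (fun j => f fun i => M i j) = fun j => r fun i => M i j := by
      funext j
      simpa using (hrf ⟨j, j.2.trans_le hk⟩).symm
    rw [heq]
    exact hr S M hM

theorem idempotent_of_isPolymorphism (h_singleton : ∀ a : A, ∃ R : L.Relations 1, ∀ x : Fin 1 → A,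
      Language.Structure.RelMap R x ↔ x 0 = a) {f : (Fin m → A) → A} (hf : IsPolymorphism L f)
    (a : A) : f (fun _ => a) = a := by
  obtain ⟨S, hS⟩ := h_singleton a
  exact (hS _).1 (hf S (fun _ _ => a) fun _ => (hS _).2 rfl)

/-- Here θ ≤ 2θ - 2, and the extra factor, being at least 2, pays for the 1/2. -/
theorem pow_le_half_pow {θ : ℕ} (hθ : 2 ≤ θ) (M : ℕ) :
    (θ : ℚ) ^ M ≤ 1 / 2 * (2 * (θ : ℚ) - 2) ^ (M + 1) := by
  have h2 : (2 : ℚ) ≤ θ := by exact_mod_cast hθ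
  have h : (θ : ℚ) ^ M ≤ (2 * (θ : ℚ) - 2) ^ M := by gcongr; linarith
  have h0 : (0 : ℚ) ≤ (θ : ℚ) ^ M := by positivity
  rw [pow_succ]
  nlinarith

end Polymorphisms

end JonssonAbsorption

theorem theorem3 {L : FirstOrder.Language} [L.IsRelational] {A : Type*} [Finite A] [L.Structure A]
    (θ : ℕ) (hθ : 2 ≤ θ)
    (h_singleton : ∀ a : A, ∃ R : L.Relations 1, ∀ x : Fin 1 → A,
      FirstOrder.Language.Structure.RelMap R x ↔ x 0 = a)
    (h_arity : ∀ k : ℕ, Nonempty (L.Relations k) → k ≤ θ)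
    (B : (Absorption.Pol L A).Substructure A) (hB : Absorption.IsJonssonAbsorbing B) :
    ∃ n : ℕ, (n : ℚ) ≤ 1 / 2 * (2 * (θ : ℚ) - 2) ^ (3 ^ Nat.card A) + 1 ∧
      Absorption.AbsorbsViaArity B n := by
  classical
  have := Fintype.ofFinite A
  obtain ⟨n, d, hdB, hlink, hfirst, hlast⟩ := hB
  set M := 3 ^ Fintype.card A - 1 with hM
  have hM1 : 3 ^ Nat.card A = M + 1 := by
    rw [Nat.card_eq_fintype_card, hM, Nat.sub_add_cancel (Nat.one_le_pow _ _ (by norm_num))]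
  set W : Set (Fin (θ ^ M + 1) → A) := {x | ∃ i, ∀ j, j ≠ i → x j ∈ B}
  have hbad : ∀ x : Fin (θ ^ M + 1) → A, ∃ i, x ∈ W → ∀ j, j ≠ i → x j ∈ B := by
    intro x
    by_cases hx : x ∈ W
    · obtain ⟨i, hi⟩ := hx
      exact ⟨i, fun _ => hi⟩
    · exact ⟨0, fun h => absurd h hx⟩
  choose bad hbad using hbad
  obtain ⟨f, hf, hfB⟩ := JonssonAbsorption.exists_solution (W := W) (B := (B : Set A))
    (R := {f : (Fin (θ ^ M + 1) → A) → A | Absorption.IsPolymorphism L f})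
    (d := fun i x y z => (d i).realize ![x, y, z]) hθ ⟨hfirst, hlast, hlink⟩
    (by
      intro k _ f hf g hg h hh
      have := JonssonAbsorption.isPolymorphism_realize (d k) (v := ![f, g, h])
        (by intro a; fin_cases a <;> assumption)
      have heq : (fun x => (d k).realize fun a => ![f, g, h] a x) =
          fun x => (d k).realize ![f x, g x, h x] := by
        funext x
        congr 1
        funext a
        fin_cases a <;> rfl
      rw [heq] at this
      exact this)
    (fun k hk a ha b c hc => hdB k hk a ha b c hc)
    (fun f hf => JonssonAbsorption.isPolymorphism_of_local h_arity (Nat.succ_pos _) hf)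
    -- The `i`-th projection avoids the label `i`: a tuple of `W` labelled otherwise has its `i`-th
    -- entry in `B`.
    bad (fun i => ⟨_, JonssonAbsorption.isPolymorphism_proj i, fun w hw hi => hbad w hw i hi.symm⟩)
    (by rw [Fintype.card_fin]; exact Nat.lt_succ_self _)
  refine ⟨θ ^ M + 1, ?_, .func (⟨f, Nat.succ_pos _, hf⟩ : (Absorption.Pol L A).Functions _) .var,
    Nat.succ_pos _, JonssonAbsorption.idempotent_of_isPolymorphism h_singleton hf,
    fun i x hx => hfB x ⟨i, hx⟩⟩
  rw [hM1]
  push_cast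
  linarith [JonssonAbsorption.pow_le_half_pow hθ M]
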